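/- Work with deterministic multi-tape (multi-stack) Turing machines with finite alphabets. A language $L\subseteq\{0,1\}^*$ is in $\mathrm{PSPACE}$ if some such machine decides it and uses, on every input $q$, space at most $s(|q|)$ for a polynomial $s$. A judge is a function $H$ that assigns a bit to every question $q\in\{0,1\}^*$ and finite list of statements $x_0,x_1,\dots\in\{0,1\}^*$; it is a polynomial-time judge if it is computed in time polynomial in the length of the word $q\#x_0\#x_1\cdots$. In the debate game on $q$ with $n$ steps, statement length bound $m$ and judge $H$, Alice and Bob alternately choose statements $x_0,\dots,x_{n-1}\in\{0,1\}^{\le m}$, each depending on the earlier ones; Alice chooses $x_0,x_2,\dots$ and Bob chooses $x_1,x_3,\dots$. Alice wins if $H(q,x_0,\dots,x_{n-1})=1$, and otherwise Bob wins. Optimal play is an equilibrium of this zero-sum game: a pair of strategies such that neither player can turn a loss into a win by changing only their own strategy. **Theorem.** For every language $L\in\mathrm{PSPACE}$ there are a polynomial-time judge $H$ and polynomials $n,m$ with natural number coefficients, with $n(k)$ odd for every $k\in\mathbb N$, such that for every $q\in\{0,1\}^*$, writing $n=n(|q|)$ and letting all $x_i$ range over $\{0,1\}^{\le m(|q|)}$,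 $$q\in L\iff \exists x_0\,\forall x_1\,\exists x_2\cdots\exists x_{n-1}.\; H(q,x_0,\dots,x_{n-1})=1 .$$ Moreover, for every $q$, optimal play in the debate game on $q$ with $n(|q|)$ steps, statement length bound $m(|q|)$ and judge $H$ exists, and under every optimal play the judge's verdict is $1$ if and only if $q\in L$. -/

import Mathlib

namespace Debate

open Turing StateTransition Computability

/-! ### Polynomial space -/

/-- The space used by a configuration of a multi-stack Turing machine: the total number of symbols
on all its stacks, the input stack included. -/
def cfgSpace (tm : FinTM2) (c : tm.Cfg) : ℕ :=
  letI := tm.kFin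
  ∑ k : tm.K, (TM2.Cfg.stk c k).length

/-- `L ∈ PSPACE`: some Turing machine with finite stack alphabets halts on every input `q`, with
output the bit saying whether `q ∈ L`, and every configuration that it visits on the input `q` uses
space at most `s(|q|)`, for a polynomial `s`. -/
def InPSPACE (L : Language Bool) : Prop :=
  ∃ (f : List Bool → Bool) (M : TM2Computable (fun q : List Bool => q) encodeBool f)
    (s : Polynomial ℕ),
    (∀ k, Finite (M.tm.Γ k)) ∧
    (∀ q, f q = true ↔ q ∈ L) ∧
    ∀ (q : List Bool) (c : M.tm.Cfg),
      Reaches M.tm.step (initList M.tm (q.map M.inputAlphabet.invFun)) c →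
        cfgSpace M.tm c ≤ s.eval q.length

/-! ### Polynomial time judges -/

/-- A question `q` with statements `x₀, x₁, …` written as the word `q # x₀ # x₁ …`; the
separator `#` is the symbol `none`. -/
def encodeTranscript (t : List Bool × List (List Bool)) : List (Option Bool) :=
  t.1.map some ++ t.2.flatMap fun x => none :: x.map some

/-- The judge `H`, a function of a question and a list of statements, is computed by a Turing
machine with finite stack alphabets in time polynomial in the length of its input. -/
def IsPolyTimeJudge (H : List Bool → List (List Bool) → Bool) : Prop :=
  ∃ M : TM2ComputableInPolyTime encodeTranscript encodeBool
      (fun t : List Bool × List (List Bool) => H t.1 t.2),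
    ∀ k, Finite (M.tm.Γ k)

/-! ### The debate game -/

/-- A statement in a debate: a bit string of length at most `m`. -/
abbrev Move (m : ℕ) : Type := {x : List Bool // x.length ≤ m}

/-- `Alternating true n P` is `∃ x₀, ∀ x₁, ∃ x₂, …, P [x₀, …, xₙ₋₁]` with `n` quantifiers, and
`Alternating false n P` is `∀ x₀, ∃ x₁, ∀ x₂, …, P [x₀, …, xₙ₋₁]`. -/
def Alternating {α : Type} : Bool → ℕ → (List α → Prop) → Prop
  | _, 0, P => P []
  | true, n + 1, P => ∃ x, Alternating false n fun l => P (x :: l)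
  | false, n + 1, P => ∀ x, Alternating true n fun l => P (x :: l)

/-- The verdict of the judge `H` on the question `q` after the debate `l`; `true` means that Alice
wins and `false` that Bob wins. -/
def verdict (H : List Bool → List (List Bool) → Bool) (q : List Bool) {m : ℕ}
    (l : List (Move m)) : Bool :=
  H q (l.map Subtype.val)

/-- A strategy chooses the next statement, given all the statements made so far. -/
abbrev Strategy (m : ℕ) : Type := List (Move m) → Move m

/-- The first `i` statements of the debate in which Alice plays `σ` and makes the statements
`x₀, x₂, …`, and Bob plays `τ` and makes the statements `x₁, x₃, …`. -/
def play {m : ℕ} (σ τ : Strategy m) : ℕ → List (Move m)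
  | 0 => []
  | i + 1 => play σ τ i ++ [if Even i then σ (play σ τ i) else τ (play σ τ i)]

/-- Optimal play in the zero-sum debate game with `n` statements on the question `q`: the pair
`(σ, τ)` is an equilibrium, i.e. neither Alice nor Bob can turn a loss into a win by changing her or
his own strategy. -/
def IsOptimalPlay (H : List Bool → List (List Bool) → Bool) (q : List Bool) (n : ℕ) {m : ℕ}
    (σ τ : Strategy m) : Prop :=
  (∀ σ' : Strategy m,
    verdict H q (play σ' τ n) = true → verdict H q (play σ τ n) = true) ∧
  (∀ τ' : Strategy m,
    verdict H q (play σ τ' n) = false → verdict H q (play σ τ n) = false)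

end Debate

/-!
Alice claims that the configuration reached after `2 ^ T` steps, where halted configurations stay
put, is the accepting one. She names the configuration halfway, and Bob chooses the half of the run
in which he does not believe. After `T` rounds the interval between the two endpoints is claimed to
be a single step, and this can be checked in linear time. Alice has a winning strategy if and only
if her claim is true. A machine in polynomial space has at most `2 ^ T` configurations for a
polynomial `T`, so its run has halted by then.

The judge must not trust that a statement of Alice describes a configuration of bounded size, or a
configuration at all. Every bit string is therefore read as a list of items to be pushed on the
stacks, and the step function is extended to all the points that arise in this way. A debate that
goes well for Alice may then pass through spurious points, but by determinism the claim that she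
proves about the endpoints is still true.
-/

namespace Debate

open Turing StateTransition Computability

section Determinacy

/-- After the moves `p` of a game with `n` moves in which the first player makes the moves number
`0, 2, …`, she can enforce `P`. -/
def Enforceable {α : Type} (n : ℕ) (P : List α → Prop) (p : List α) : Prop :=
  Alternating (decide (Even p.length)) (n - p.length) fun l => P (p ++ l)

section Enforceable

variable {α : Type} {n : ℕ} {P : List α → Prop} {p : List α}

theorem enforceable_nil : Enforceable n P [] ↔ Alternating true n P := by
  simp [Enforceable]

theorem enforceable_of_length_eq (hp : p.length = n) : Enforceable n P p ↔ P p := by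
  simp [Enforceable, hp, Alternating]

theorem enforceable_of_even (hp : p.length < n) (he : Even p.length) :
    Enforceable n P p ↔ ∃ x, Enforceable n P (p ++ [x]) := by
  obtain ⟨k, hk⟩ := Nat.exists_eq_add_of_lt hp
  have hsucc : n - p.length = k + 1 := by omega
  simp [Enforceable, Nat.even_add_one, he, hsucc, ← Nat.sub_sub, Alternating]

theorem enforceable_of_odd (hp : p.length < n) (ho : ¬ Even p.length) :
    Enforceable n P p ↔ ∀ x, Enforceable n P (p ++ [x]) := by
  obtain ⟨k, hk⟩ := Nat.exists_eq_add_of_lt hp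
  have hsucc : n - p.length = k + 1 := by omega
  simp [Enforceable, Nat.even_add_one, ho, hsucc, ← Nat.sub_sub, Alternating]

end Enforceable

variable {m n : ℕ}

instance : Nonempty (Move m) := ⟨⟨[], Nat.zero_le m⟩⟩

theorem exists_choice_function {α : Type*} [Nonempty α] (W : List α → Prop) :
    ∃ σ : List α → α, ∀ p, (∃ x, W (p ++ [x])) → W (p ++ [σ p]) :=
  ⟨fun p => Classical.epsilon fun x => W (p ++ [x]), fun _ => Classical.epsilon_spec⟩

theorem length_play (σ τ : Strategy m) (i : ℕ) : (play σ τ i).length = i := by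
  induction i with
  | zero => rfl
  | succ i ih => simp [play, ih]

theorem exists_winning_strategy {P : List (Move m) → Prop} (h : Alternating true n P) :
    ∃ σ : Strategy m, ∀ τ, P (play σ τ n) := by
  obtain ⟨σ, hσ⟩ := exists_choice_function (Enforceable n P)
  refine ⟨σ, fun τ => (enforceable_of_length_eq (length_play σ τ n)).1 ?_⟩
  suffices ∀ i ≤ n, Enforceable n P (play σ τ i) from this n le_rfl
  intro i hi
  induction i with
  | zero => exact enforceable_nil.2 h
  | succ i ih =>
    have hlt : (play σ τ i).length < n := by rwa [length_play]
    by_cases he : Even (play σ τ i).length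
    · rw [play, if_pos (by rwa [length_play] at he)]
      exact hσ _ ((enforceable_of_even hlt he).1 (ih (by omega)))
    · exact (enforceable_of_odd hlt he).1 (ih (by omega)) _

theorem exists_refuting_strategy {P : List (Move m) → Prop} (h : ¬ Alternating true n P) :
    ∃ τ : Strategy m, ∀ σ, ¬ P (play σ τ n) := by
  obtain ⟨τ, hτ⟩ := exists_choice_function fun p => ¬ Enforceable n P p
  refine ⟨τ, fun σ => mt (enforceable_of_length_eq (length_play σ τ n)).2 ?_⟩
  suffices ∀ i ≤ n, ¬ Enforceable n P (play σ τ i) from this n le_rfl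
  intro i hi
  induction i with
  | zero => exact mt enforceable_nil.1 h
  | succ i ih =>
    have hlt : (play σ τ i).length < n := by rwa [length_play]
    by_cases he : Even (play σ τ i).length
    · exact not_exists.1 (mt (enforceable_of_even hlt he).2 (ih (by omega))) _
    · rw [play, if_neg (by rwa [length_play] at he)]
      exact hτ _ (not_forall.1 (mt (enforceable_of_odd hlt he).2 (ih (by omega))))

variable (H : List Bool → List (List Bool) → Bool) (q : List Bool)

theorem exists_isOptimalPlay (n m : ℕ) : ∃ σ τ : Strategy m, IsOptimalPlay H q n σ τ := by
  by_cases h : Alternating true n fun l : List (Move m) => verdict H q l = true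
  · obtain ⟨σ, hσ⟩ := exists_winning_strategy h
    exact ⟨σ, σ, fun _ _ => hσ σ, fun τ' hτ' => absurd (hσ τ') (Bool.eq_false_iff.1 hτ')⟩
  · obtain ⟨τ, hτ⟩ := exists_refuting_strategy h
    exact ⟨τ, τ, fun σ' hσ' => absurd hσ' (hτ σ'), fun _ _ => Bool.eq_false_iff.2 (hτ τ)⟩

variable {H q}

theorem IsOptimalPlay.verdict_eq_true_iff {σ τ : Strategy m} (h : IsOptimalPlay H q n σ τ) :
    verdict H q (play σ τ n) = true ↔
      Alternating true n fun l : List (Move m) => verdict H q l = true := by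
  constructor
  · intro hv
    by_contra hn
    obtain ⟨τ', hτ'⟩ := exists_refuting_strategy hn
    exact Bool.eq_false_iff.1 (h.2 τ' (Bool.eq_false_iff.2 (hτ' σ))) hv
  · intro ha
    obtain ⟨σ', hσ'⟩ := exists_winning_strategy ha
    exact h.1 σ' (hσ' τ)

end Determinacy

section Halving

variable {α β : Type*} {μ : Type}

/-- Halving an interval: of the moves `x₀, y₀, x₁, y₁, …`, each `x` proposes the point `point x`
between the endpoints, and the bit `upper y` says whether `x` becomes the left endpoint (so that the
upper half remains) or the right one. A last `x` without a `y` has no effect. -/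
def halve (point : μ → α) (upper : μ → Bool) : α × α → List μ → α × α
  | I, x :: y :: l => halve point upper (if upper y then (point x, I.2) else (I.1, point x)) l
  | I, _ => I

theorem halve_map {ν : Type} (e : ν → μ) (g : α → β) (point : μ → α) (upper : μ → Bool) (a b : α)
    (l : List ν) :
    halve (fun x => g (point (e x))) (fun y => upper (e y)) (g a, g b) l =
      Prod.map g g (halve point upper (a, b) (l.map e)) := by
  induction l using List.twoStepInduction generalizing a b with
  | nil => rfl
  | singleton x => rfl
  | cons_cons x y l ih =>
    simp only [halve, List.map_cons]
    split_ifs <;> exact ih ..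

/-- The endpoints of `I` are one step of `f` apart. -/
def IsStep (f : α → α) (I : α × α) : Prop :=
  f I.1 = I.2

variable {f : α → α} {point : μ → α} {upper : μ → Bool} {a b : α}

theorem iterate_eq_of_alternating (hupper : Function.Surjective upper) (T : ℕ)
    (h : Alternating true (2 * T + 1) fun l => IsStep f (halve point upper (a, b) l)) :
    f^[2 ^ T] a = b := by
  induction T generalizing a b with
  | zero =>
    obtain ⟨_, hstep⟩ := h
    exact hstep
  | succ T ih =>
    obtain ⟨x, hx⟩ := h
    have half (y : μ) : Alternating true (2 * T + 1) fun l =>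
        IsStep f (halve point upper (if upper y then (point x, b) else (a, point x)) l) := hx y
    obtain ⟨y₀, hy₀⟩ := hupper false
    obtain ⟨y₁, hy₁⟩ := hupper true
    have lower_half : f^[2 ^ T] a = point x := ih (by simpa [hy₀] using half y₀)
    have upper_half : f^[2 ^ T] (point x) = b := ih (by simpa [hy₁] using half y₁)
    rw [pow_succ, mul_two, Function.iterate_add_apply, lower_half, upper_half]

theorem alternating_of_iterate_eq (T : ℕ) (horbit : ∀ i, ∃ x, point x = f^[i] a)
    (h : f^[2 ^ T] a = b) :
    Alternating true (2 * T + 1) fun l => IsStep f (halve point upper (a, b) l) := by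
  induction T generalizing a b with
  | zero => exact ⟨(horbit 0).choose, h⟩
  | succ T ih =>
    obtain ⟨x, hx⟩ := horbit (2 ^ T)
    refine ⟨x, fun y => ?_⟩
    change Alternating true (2 * T + 1) fun l =>
      IsStep f (halve point upper (if upper y then (point x, b) else (a, point x)) l)
    split_ifs
    · refine ih (fun i => ?_) ?_
      · rw [hx, ← Function.iterate_add_apply]
        exact horbit _
      · rw [hx, ← Function.iterate_add_apply, ← mul_two, ← pow_succ, h]
    · exact ih horbit hx.symm

end Halving

section Orbits

variable {α β : Type*}

theorem iterate_card_eq_of_orbit_subset_range [Finite β] {f : α → α} {a b : α} (g : β → α)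
    (horbit : ∀ i, ∃ x, g x = f^[i] a) (hfixed : f b = b) {n : ℕ} (hn : f^[n] a = b) {N : ℕ}
    (hN : Nat.card β ≤ N) : f^[N] a = b := by
  have hstay {i j : ℕ} (hi : f^[i] a = b) (hij : i ≤ j) : f^[j] a = b := by
    rw [← Nat.sub_add_cancel hij, Function.iterate_add_apply, hi, Function.iterate_fixed hfixed]
  choose x hx using horbit
  obtain ⟨i, j, hij, hxij⟩ : ∃ i j : Fin (Nat.card β + 1), i < j ∧ x i = x j := by
    have := Fintype.ofFinite β
    obtain ⟨i, j, hne, hxij⟩ := Fintype.exists_ne_map_eq_of_card_lt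
      (fun i : Fin (Nat.card β + 1) => x i) (by simp)
    rcases hne.lt_or_gt with h | h
    exacts [⟨i, j, h, hxij⟩, ⟨j, i, h, hxij.symm⟩]
  have hperiodic : Function.IsPeriodicPt f (j - i) (f^[i] a) := by
    rw [Function.IsPeriodicPt, Function.IsFixedPt, ← Function.iterate_add_apply,
      Nat.sub_add_cancel (Fin.le_def.1 hij.le), ← hx, ← hx, hxij]
  have hi : f^[i] a = b := by
    rw [← (hperiodic.const_mul n).eq, ← Function.iterate_add_apply]
    exact hstay hn (Nat.le_add_right_of_le (Nat.le_mul_of_pos_right n (Nat.sub_pos_of_lt hij)))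
  exact hstay hi (by omega)

theorem injective_getElem?_of_length_le (m : ℕ) :
    Function.Injective fun (x : {x : List β // x.length ≤ m}) (i : Fin m) => x.1[(i : ℕ)]? := by
  intro x y h
  refine Subtype.ext (List.ext_getElem? fun i => ?_)
  by_cases hi : i < m
  · exact congrFun h ⟨i, hi⟩
  · rw [List.getElem?_eq_none (x.2.trans (not_lt.1 hi)),
      List.getElem?_eq_none (y.2.trans (not_lt.1 hi))]

instance [Finite β] (m : ℕ) : Finite {x : List β // x.length ≤ m} :=
  Finite.of_injective _ (injective_getElem?_of_length_le m)

theorem card_list_length_le [Finite β] (m : ℕ) :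
    Nat.card {x : List β // x.length ≤ m} ≤ (Nat.card β + 1) ^ m := by
  simpa [Nat.card_fun, Finite.card_option] using
    Nat.card_le_card_of_injective _ (injective_getElem?_of_length_le (β := β) m)

/-- The partial map `f` made total by letting it stay at the points where it is undefined. -/
def stayingStep (f : α → Option α) (a : α) : α :=
  (f a).getD a

theorem iterate_stayingStep_of_evalsTo {f : α → Option α} {a b : α} (h : EvalsTo f a (some b)) :
    (stayingStep f)^[h.steps] a = b := by
  obtain ⟨n, h⟩ := h
  change (stayingStep f)^[n] a = b
  have hnone (n : ℕ) : (flip bind f)^[n] none = none := Function.iterate_fixed rfl n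
  induction n generalizing a with
  | zero => exact Option.some.inj h
  | succ n ih =>
    rw [Function.iterate_succ_apply] at h ⊢
    change (flip bind f)^[n] (f a) = some b at h
    cases hfa : f a with
    | none =>
      rw [hfa, hnone] at h
      cases h
    | some c =>
      rw [stayingStep, hfa]
      exact ih (hfa ▸ h)

theorem reaches_iterate_stayingStep (f : α → Option α) (a : α) (n : ℕ) :
    Reaches f a ((stayingStep f)^[n] a) := by
  induction n with
  | zero => exact .refl
  | succ n ih =>
    rw [Function.iterate_succ_apply', stayingStep]
    cases hf : f ((stayingStep f)^[n] a) with
    | none => exact ih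
    | some c => exact ih.tail hf

end Orbits

section StackMachines

section Runs

variable {α : Type*} {f : α → Option α} {a b c : α} {s t : ℕ}

/-- `b` is reached from `a` in at most `t` steps of `f`. -/
def ReachesWithin (f : α → Option α) (t : ℕ) (a b : α) : Prop :=
  Nonempty (EvalsToInTime f a (some b) t)

theorem ReachesWithin.single (h : f a = some b) : ReachesWithin f 1 a b :=
  ⟨⟨⟨1, h⟩, le_rfl⟩⟩

theorem ReachesWithin.trans (h₁ : ReachesWithin f s a b) (h₂ : ReachesWithin f t b c) :
    ReachesWithin f (t + s) a c :=
  h₁.elim fun h₁ => h₂.elim fun h₂ => ⟨.trans f _ _ a b _ h₁ h₂⟩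

theorem ReachesWithin.mono (h : ReachesWithin f s a b) (hst : s ≤ t) : ReachesWithin f t a b :=
  h.elim fun h => ⟨⟨h.toEvalsTo, h.steps_le_m.trans hst⟩⟩

theorem ReachesWithin.head (h₁ : f a = some b) (h₂ : ReachesWithin f t b c) :
    ReachesWithin f (t + 1) a c :=
  (ReachesWithin.single h₁).trans h₂

end Runs

variable {K : Type*} [DecidableEq K] {Γ : K → Type*} {Λ σ : Type*}

/-- The number of symbols that a statement may push. -/
def pushCount : TM2.Stmt Γ Λ σ → ℕ
  | .push _ _ s => pushCount s + 1
  | .peek _ _ s => pushCount s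
  | .pop _ _ s => pushCount s
  | .load _ s => pushCount s
  | .branch _ s t => pushCount s + pushCount t
  | .goto _ => 0
  | .halt => 0

theorem length_stepAux_le (s : TM2.Stmt Γ Λ σ) (v : σ) (S : ∀ k, List (Γ k)) (k : K) :
    ((TM2.stepAux s v S).stk k).length ≤ (S k).length + pushCount s := by
  induction s generalizing v S with
  | push k' f s ih =>
    refine (ih _ _).trans ?_
    obtain rfl | hk := eq_or_ne k k'
    · simp only [Function.update_self, List.length_cons, pushCount]
      omega
    · simp only [Function.update_of_ne hk, pushCount]
      omega
  | peek _ _ _ ih | load _ _ ih => exact ih _ _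
  | pop k' f s ih =>
    refine (ih _ _).trans ?_
    obtain rfl | hk := eq_or_ne k k'
    · simp [pushCount]
    · simp [Function.update_of_ne hk, pushCount]
  | branch f s t ihs iht =>
    simp only [TM2.stepAux, pushCount]
    cases f v
    · exact (iht _ _).trans (by omega)
    · exact (ihs _ _).trans (by omega)
  | goto | halt => exact le_rfl

/-- Push the symbols of the list `l` on the stack `k`, the first one first, then execute `s`. -/
def pushAll (k : K) (l : List (Γ k)) (s : TM2.Stmt Γ Λ σ) : TM2.Stmt Γ Λ σ :=
  l.foldr (fun y s => .push k (fun _ => y) s) s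

theorem stepAux_pushAll (k : K) (l : List (Γ k)) (s : TM2.Stmt Γ Λ σ) (v : σ)
    (S : ∀ k, List (Γ k)) :
    TM2.stepAux (pushAll k l s) v S =
      TM2.stepAux s v (Function.update S k (l.reverse ++ S k)) := by
  induction l generalizing S with
  | nil => simp [pushAll]
  | cons y l ih => exact (ih (Function.update S k (y :: S k))).trans (by simp)

/-- Pop every stack of the list `l`, then execute `s`; if one of these stacks is not empty, then
`s` starts in the state `dirty`. -/
def popAll (l : List K) (dirty : σ) (s : TM2.Stmt Γ Λ σ) : TM2.Stmt Γ Λ σ :=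
  l.foldr (fun k s => .pop k (fun v o => if o.isSome then dirty else v) s) s

open Classical in
theorem stepAux_popAll {l : List K} (hl : l.Nodup) (dirty : σ) (s : TM2.Stmt Γ Λ σ) (v : σ)
    (S : ∀ k, List (Γ k)) :
    TM2.stepAux (popAll l dirty s) v S =
      TM2.stepAux s (if ∀ k ∈ l, S k = [] then v else dirty)
        fun k => if k ∈ l then (S k).tail else S k := by
  induction l generalizing v S with
  | nil => simp [popAll]
  | cons k l ih =>
    obtain ⟨hk, hl⟩ := List.nodup_cons.1 hl
    have hS {k'} (hk' : k' ∈ l) : Function.update S k (S k).tail k' = S k' :=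
      Function.update_of_ne (ne_of_mem_of_not_mem hk' hk) ..
    have hempty : (∀ k' ∈ l, Function.update S k (S k).tail k' = []) ↔ ∀ k' ∈ l, S k' = [] :=
      forall₂_congr fun k' hk' => by rw [hS hk']
    change TM2.stepAux (popAll l dirty s) (if (S k).head?.isSome then dirty else v)
      (Function.update S k (S k).tail) = _
    rw [ih hl]
    congr 1
    · simp only [hempty]
      cases hSk : S k <;> simp [hSk]
    · funext k'
      by_cases hk' : k' ∈ l
      · simp [hk', hS hk']
      · obtain rfl | hne := eq_or_ne k' k
        · simp [hk]
        · simp [hk', hne]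

end StackMachines

section Points

variable (tm : FinTM2)

/-- The alphabets of the stacks describing a configuration of `tm`: the additional stack `none`
holds the label and the internal state. -/
abbrev PointSymbol : Option tm.K → Type
  | none => Option tm.Λ × tm.σ
  | some k => tm.Γ k

/-- Stack contents describing a configuration of `tm`. Only the points whose stack `none` is a
singleton are configurations, but one step of `tm` makes sense at every point. -/
abbrev Point : Type := ∀ k, List (PointSymbol tm k)

/-- A symbol together with the stack it lies on; a list of items describes a point. -/
abbrev Item : Type := Σ k, PointSymbol tm k

variable {tm}

/-- The point with header stack `t` and the stacks `S` of `tm`. -/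
def Point.mk (t : List (Option tm.Λ × tm.σ)) (S : ∀ k, List (tm.Γ k)) : Point tm
  | none => t
  | some k => S k

/-- The point describing a configuration. -/
def toPoint (c : tm.Cfg) : Point tm :=
  Point.mk [(TM2.Cfg.l c, TM2.Cfg.var c)] (TM2.Cfg.stk c)

/-- One step of `tm`, as a total map on points, which fixes the points that are not running. -/
def pointStep (X : Point tm) : Point tm :=
  match X none with
  | (some l, v) :: t =>
    let c := TM2.stepAux (tm.m l) v fun k => X (some k)
    Point.mk ((c.l, c.var) :: t) c.stk
  | _ => X

theorem Point.mk_eta (X : Point tm) : Point.mk (X none) (fun k => X (some k)) = X := by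
  funext k
  cases k <;> rfl

theorem Point.update_mk_none (t t' : List (Option tm.Λ × tm.σ)) (S : ∀ k, List (tm.Γ k)) :
    Function.update (Point.mk t S) none t' = Point.mk t' S := by
  refine Function.update_eq_iff.2 ⟨rfl, fun k hk => ?_⟩
  cases k
  · exact absurd rfl hk
  · rfl

theorem Point.update_mk_some (t : List (Option tm.Λ × tm.σ)) (S : ∀ k, List (tm.Γ k)) (k : tm.K)
    (l : List (tm.Γ k)) :
    Function.update (Point.mk t S) (some k) l = Point.mk t (Function.update S k l) := by
  refine Function.update_eq_iff.2 ⟨(Function.update_self (β := fun k => List (tm.Γ k)) ..).symm,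
    fun k' hk' => ?_⟩
  cases k'
  · rfl
  · exact (Function.update_of_ne (β := fun k => List (tm.Γ k)) (by simpa using hk') ..).symm

theorem toPoint_injective : Function.Injective (toPoint (tm := tm)) := by
  rintro ⟨l, v, S⟩ ⟨l', v', S'⟩ h
  obtain ⟨⟨⟩⟩ : [(l, v)] = [(l', v')] := congrFun h none
  obtain rfl : S = S' := funext fun k => congrFun h (some k)
  rfl

theorem iterate_pointStep_toPoint (c : tm.Cfg) (n : ℕ) :
    pointStep^[n] (toPoint c) = toPoint ((stayingStep tm.step)^[n] c) := by
  have hsemi : Function.Semiconj toPoint (stayingStep tm.step) pointStep := by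
    rintro ⟨_ | l, v, S⟩ <;> rfl
  exact ((hsemi.iterate_right n).eq c).symm

theorem haltList_injective (tm : FinTM2) : Function.Injective (haltList tm) := by
  intro y y' h
  simpa [haltList] using congrFun (congrArg TM2.Cfg.stk h) tm.k₁

/-- A bound for the number of symbols pushed in one step of `tm`. -/
def maxPush (tm : FinTM2) : ℕ :=
  letI := tm.ΛFin
  ∑ l, pushCount (tm.m l)

theorem length_pointStep_le (X : Point tm) (k : Option tm.K) :
    (pointStep X k).length ≤ (X k).length + maxPush tm := by
  let _ := tm.ΛFin
  rcases hX : X none with _ | ⟨⟨_ | l, v⟩, t⟩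
  · simp [pointStep, hX]
  · simp [pointStep, hX]
  simp only [pointStep, hX]
  cases k with
  | none => simp [Point.mk, hX]
  | some k =>
    exact (length_stepAux_le (tm.m l) v (fun k => X (some k)) k).trans <| Nat.add_le_add_left
      (Finset.single_le_sum (f := fun l => pushCount (tm.m l)) (by simp) (Finset.mem_univ l)) _

end Points

section Items

variable {tm : FinTM2}

/-- Push an item on its stack. -/
def pushItem (a : Item tm) (X : Point tm) : Point tm :=
  Function.update X a.1 (a.2 :: X a.1)

/-- Push all items of a list, the last one first. -/
def pushItems (l : List (Item tm)) (X : Point tm) : Point tm :=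
  l.foldr pushItem X

/-- The point described by a list of items. -/
def ofItems (l : List (Item tm)) : Point tm :=
  pushItems l fun _ => []

theorem pushItem_eq_iff (a : Item tm) (X Y : Point tm) :
    pushItem a X = Y ↔ (Y a.1).head? = some a.2 ∧ X = Function.update Y a.1 (Y a.1).tail := by
  constructor
  · rintro rfl
    simp [pushItem]
  · rintro ⟨h, rfl⟩
    obtain ⟨t, ht⟩ := List.head?_eq_some_iff.1 h
    rw [pushItem, Function.update_self, Function.update_idem, ht, List.tail_cons, ← ht,
      Function.update_eq_self]

theorem length_pushItem_le (a : Item tm) (X : Point tm) (k : Option tm.K) :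
    (pushItem a X k).length ≤ (X k).length + 1 := by
  obtain rfl | hk := eq_or_ne k a.1
  · simp [pushItem]
  · simp [pushItem, Function.update_of_ne hk]

/-- The items lying on the stack `k` of `tm`. -/
def stackItems (k : tm.K) (l : List (tm.Γ k)) : List (Item tm) :=
  l.map fun y => ⟨some k, y⟩

theorem pushItems_append (l l' : List (Item tm)) (X : Point tm) :
    pushItems (l ++ l') X = pushItems l (pushItems l' X) :=
  List.foldr_append

theorem pushItems_stackItems (k : tm.K) (l : List (tm.Γ k)) (X : Point tm) :
    pushItems (stackItems k l) X = Function.update X (some k) (l ++ X (some k)) := by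
  induction l with
  | nil => simp [pushItems, stackItems]
  | cons y l ih =>
    change pushItem _ (pushItems (stackItems k l) X) = _
    simp [ih, pushItem]

theorem ofItems_flatMap_stackItems {ks : List tm.K} (hks : ks.Nodup) (S : ∀ k, List (tm.Γ k)) :
    ofItems (ks.flatMap fun k => stackItems k (S k)) =
      Point.mk [] fun k => if k ∈ ks then S k else [] := by
  induction ks with
  | nil => exact (Point.mk_eta fun _ => []).symm
  | cons k ks ih =>
    obtain ⟨hk, hks⟩ := List.nodup_cons.1 hks
    rw [ofItems, List.flatMap_cons, pushItems_append, ← ofItems, ih hks, pushItems_stackItems,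
      Point.update_mk_some]
    congr 1
    refine Function.update_eq_iff.2 ⟨?_, fun k' hk' => ?_⟩
    · simp [Point.mk, hk]
    · simp [hk']

/-- The item holding the label and the internal state of a configuration. -/
def headerItem (c : tm.Cfg) : Item tm :=
  ⟨none, (TM2.Cfg.l c, TM2.Cfg.var c)⟩

/-- The items of a configuration. -/
noncomputable def cfgItems (c : tm.Cfg) : List (Item tm) :=
  letI := tm.kFin
  headerItem c :: (Finset.univ : Finset tm.K).toList.flatMap fun k =>
    stackItems k (TM2.Cfg.stk c k)

theorem ofItems_cfgItems (c : tm.Cfg) : ofItems (cfgItems c) = toPoint c := by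
  let _ := tm.kFin
  change pushItem (headerItem c) (ofItems _) = _
  rw [ofItems_flatMap_stackItems (Finset.nodup_toList _), pushItem, headerItem,
    Point.update_mk_none, toPoint]
  simp [Point.mk]

theorem length_cfgItems (c : tm.Cfg) : (cfgItems c).length = cfgSpace tm c + 1 := by
  let _ := tm.kFin
  simp only [cfgItems, cfgSpace, stackItems, List.length_cons, List.length_flatMap,
    List.length_map]
  rw [Finset.sum_map_toList]

theorem ofItems_header_stackItems (p : Option tm.Λ × tm.σ) (k : tm.K) (l : List (tm.Γ k)) :
    ofItems (⟨none, p⟩ :: stackItems k l) = Point.mk [p] (Function.update (fun _ => []) k l) := by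
  change pushItem _ (pushItems (stackItems k l) _) = _
  rw [pushItems_stackItems, List.append_nil, ← Point.mk_eta fun _ => [], Point.update_mk_some,
    pushItem, Point.update_mk_none]
  rfl

/-- The items of the initial configuration with input `s`. -/
def initItems (s : List (tm.Γ tm.k₀)) : List (Item tm) :=
  ⟨none, (some tm.main, tm.initialState)⟩ :: stackItems tm.k₀ s

/-- The items of the final configuration with output `s`. -/
def haltItems (s : List (tm.Γ tm.k₁)) : List (Item tm) :=
  ⟨none, (none, tm.initialState)⟩ :: stackItems tm.k₁ s

theorem ofItems_initItems (s : List (tm.Γ tm.k₀)) :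
    ofItems (initItems s) = toPoint (initList tm s) := by
  rw [initItems, ofItems_header_stackItems]
  refine congrArg (Point.mk _) (Function.update_eq_iff.2 ⟨?_, fun k hk => ?_⟩)
  · simp [initList]
  · simp [initList, hk]

theorem ofItems_haltItems (s : List (tm.Γ tm.k₁)) :
    ofItems (haltItems s) = toPoint (haltList tm s) := by
  rw [haltItems, ofItems_header_stackItems]
  refine congrArg (Point.mk _) (Function.update_eq_iff.2 ⟨?_, fun k hk => ?_⟩)
  · simp [haltList]
  · simp [haltList, hk]

end Items

section Statements

variable {tm : FinTM2}

theorem finite_pointSymbol [∀ k, Finite (tm.Γ k)] (k : Option tm.K) :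
    Finite (PointSymbol tm k) := by
  have := tm.ΛFin
  have := tm.σFin
  cases k <;> simp only [PointSymbol] <;> infer_instance

instance [∀ k, Finite (tm.Γ k)] : Finite (Item tm) := by
  have := tm.kFin
  have := finite_pointSymbol (tm := tm)
  infer_instance

instance : Nonempty (Item tm) := ⟨⟨none, (none, tm.initialState)⟩⟩

variable [∀ k, Finite (tm.Γ k)]

instance : NeZero (Nat.card (Item tm)) := ⟨Nat.card_pos.ne'⟩

/-- The items described by the rest of a statement of Alice, after `j` bits `true`: an item is
written in unary, as its number of bits `true` ended by a bit `false`. The counter is cyclic, so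
that every bit string describes some items. -/
noncomputable def statementItems : Fin (Nat.card (Item tm)) → List Bool → List (Item tm)
  | _, [] => []
  | j, true :: x => statementItems (j + 1) x
  | j, false :: x => (Finite.equivFin (Item tm)).symm j :: statementItems 0 x

/-- The point described by a statement of Alice. -/
noncomputable def statementPoint (x : List Bool) : Point tm :=
  ofItems (statementItems 0 x)

/-- The statement describing a list of items. -/
noncomputable def encodeItems (l : List (Item tm)) : List Bool :=
  l.flatMap fun a => List.replicate (Finite.equivFin (Item tm) a) true ++ [false]

theorem statementItems_replicate (j : Fin (Nat.card (Item tm))) (n : ℕ) (x : List Bool) :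
    statementItems j (List.replicate n true ++ x) =
      statementItems (j + Fin.ofNat (Nat.card (Item tm)) n) x := by
  induction n generalizing j with
  | zero => simp
  | succ n ih =>
    rw [List.replicate_succ, List.cons_append, statementItems, ih]
    congr 1
    ext
    simp [Fin.val_add, Nat.add_assoc, Nat.add_comm n 1]

theorem statementItems_encodeItems (l : List (Item tm)) :
    statementItems 0 (encodeItems l) = l := by
  induction l with
  | nil => rfl
  | cons a l ih =>
    rw [encodeItems] at ih
    simp [encodeItems, statementItems_replicate, statementItems, ih]

theorem length_encodeItems_le (l : List (Item tm)) :
    (encodeItems l).length ≤ Nat.card (Item tm) * l.length := by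
  rw [encodeItems, List.length_flatMap, mul_comm, ← smul_eq_mul, ← List.length_map]
  refine List.sum_le_card_nsmul _ _ fun n hn => ?_
  obtain ⟨a, -, rfl⟩ := List.mem_map.1 hn
  simp

theorem exists_statementPoint_eq {c : tm.Cfg} {s : ℕ} (hc : cfgSpace tm c ≤ s) :
    ∃ x : Move (Nat.card (Item tm) * (s + 1)), statementPoint x.1 = toPoint c := by
  refine ⟨⟨encodeItems (cfgItems c), (length_encodeItems_le _).trans ?_⟩, ?_⟩
  · rw [length_cfgItems]
    gcongr
  · rw [statementPoint, statementItems_encodeItems, ofItems_cfgItems]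

end Statements

section Transcripts

variable {tm : FinTM2}

/-- The symbols of a parsed transcript: items, and marks. A mark `false` follows the items of a new
right endpoint, and a mark `true` those of a new left endpoint. -/
abbrev Token (tm : FinTM2) : Type := Item tm ⊕ Bool

/-- The tokens of a block of items and its mark. -/
def markedBlock (l : List (Item tm)) (b : Bool) : List (Token tm) :=
  l.map .inl ++ [.inr b]

section Loading

/-- The state of the loader, which reads a parsed transcript backwards: the marks that have not been
seen yet, and the mark of the block that is being read if this block has to be loaded. -/
abbrev LoadState : Type := Finset Bool × Option Bool

/-- Only the last block with a given mark has to be loaded. -/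
def LoadState.mark (g : LoadState) (b : Bool) : LoadState :=
  if b ∈ g.1 then (g.1.erase b, some b) else (g.1, none)

/-- Read a token; the left endpoint is loaded as a point, and the right one as a list of items. -/
def loadToken : Token tm → LoadState × Point tm × List (Item tm) →
    LoadState × Point tm × List (Item tm)
  | .inr b, (g, X, h) => (g.mark b, X, h)
  | .inl a, ((s, some true), X, h) => ((s, some true), pushItem a X, h)
  | .inl a, ((s, some false), X, h) => ((s, some false), X, a :: h)
  | .inl _, ((s, none), X, h) => ((s, none), X, h)

/-- The last blocks of the tokens `r` with marks `true` and `false` are `I.1` and `I.2`. -/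
def LoadsAs (r : List (Token tm)) (I : List (Item tm) × List (Item tm)) : Prop :=
  ∀ s o X h, (r.foldr loadToken ((s, o), X, h)).2 =
    (if true ∈ s then pushItems I.1 X else X, if false ∈ s then I.2 ++ h else h)

/-- The left endpoint, as a point, and the right endpoint, as a list of items, of the interval
described by the tokens `r`. -/
def loaded (r : List (Token tm)) : Point tm × List (Item tm) :=
  (r.foldr loadToken ((Finset.univ, none), fun _ => [], [])).2

theorem LoadsAs.loaded_eq {r : List (Token tm)} {I : List (Item tm) × List (Item tm)}
    (hr : LoadsAs r I) : loaded r = Prod.map ofItems id I :=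
  (hr ..).trans (by simp [Prod.map, ofItems])

theorem length_foldr_loadToken_le (r : List (Token tm))
    (z : LoadState × Point tm × List (Item tm)) :
    (∀ k, ((r.foldr loadToken z).2.1 k).length ≤ (z.2.1 k).length + r.length) ∧
      (r.foldr loadToken z).2.2.length ≤ z.2.2.length + r.length := by
  induction r with
  | nil => simp
  | cons t r ih =>
    obtain ⟨hX, hh⟩ := ih
    rw [List.foldr_cons, List.length_cons]
    generalize r.foldr loadToken z = z' at *
    rcases t with a | b
    · rcases z' with ⟨⟨s, _ | _ | _⟩, X, h⟩
      · exact ⟨fun k => (hX k).trans (by omega), hh.trans (by omega)⟩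
      · exact ⟨fun k => (hX k).trans (by omega), Nat.succ_le_succ hh⟩
      · exact ⟨fun k => (length_pushItem_le a X k).trans (Nat.succ_le_succ (hX k)),
          hh.trans (by omega)⟩
    · exact ⟨fun k => (hX k).trans (by omega), hh.trans (by omega)⟩

theorem foldr_loadToken_map_inl (l : List (Item tm)) (g : LoadState) (X : Point tm)
    (h : List (Item tm)) :
    (l.map .inl).foldr loadToken (g, X, h) =
      (g, if g.2 = some true then pushItems l X else X,
        if g.2 = some false then l ++ h else h) := by
  rcases g with ⟨s, _ | _ | _⟩ <;> induction l <;> simp_all [pushItems, loadToken]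

theorem loadsAs_nil : LoadsAs (tm := tm) [] ([], []) := by
  intro s _ X h
  simp [pushItems]

theorem LoadsAs.append_markedBlock {r : List (Token tm)} {I : List (Item tm) × List (Item tm)}
    (hr : LoadsAs r I) (l : List (Item tm)) (b : Bool) :
    LoadsAs (r ++ markedBlock l b) (if b then (l, I.2) else (I.1, l)) := by
  intro s o X h
  rw [markedBlock, List.foldr_append, List.foldr_append, List.foldr_cons, List.foldr_nil, loadToken,
    foldr_loadToken_map_inl, hr]
  by_cases hb : b ∈ s <;> cases b <;> simp [LoadState.mark, hb]

end Loading

section Parsing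

variable [∀ k, Finite (tm.Γ k)]

/-- The states of the parser: inside the question, inside a statement of Alice after a number of
bits `true`, or inside a statement of Bob with given last bit. -/
inductive ParseState (tm : FinTM2) [∀ k, Finite (tm.Γ k)]
  | question
  | alice (j : Fin (Nat.card (Item tm)))
  | bob (b : Bool)

variable (inj : Bool → tm.Γ tm.k₀)

/-- The transitions of the parser, with the token that is written. -/
noncomputable def parseSymbol : ParseState tm → Option Bool → ParseState tm × Option (Token tm)
  | .question, some b => (.question, some (.inl ⟨some tm.k₀, inj b⟩))
  | .question, none => (.alice 0, some (.inr true))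
  | .alice j, some true => (.alice (j + 1), none)
  | .alice j, some false => (.alice 0, some (.inl ((Finite.equivFin (Item tm)).symm j)))
  | .alice _, none => (.bob false, none)
  | .bob _, some b => (.bob b, none)
  | .bob b, none => (.alice 0, some (.inr b))

/-- The tokens written by the parser. -/
noncomputable def parse : ParseState tm → List (Option Bool) → List (Token tm)
  | _, [] => []
  | f, c :: w => (parseSymbol inj f c).2.toList ++ parse (parseSymbol inj f c).1 w

theorem length_parse_le (f : ParseState tm) (w : List (Option Bool)) :
    (parse inj f w).length ≤ w.length := by
  induction w generalizing f with
  | nil => simp [parse]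
  | cons c w ih =>
    have := ih (parseSymbol inj f c).1
    have := Option.length_toList_le (o := (parseSymbol inj f c).2)
    simp only [parse, List.length_append, List.length_cons]
    omega

theorem parse_question (q : List Bool) (w : List (Option Bool)) :
    parse inj .question (q.map some ++ none :: w) =
      (stackItems tm.k₀ (q.map inj)).map .inl ++ .inr true :: parse inj (.alice 0) w := by
  induction q with
  | nil => rfl
  | cons b q ih => exact congrArg (.inl ⟨some tm.k₀, inj b⟩ :: ·) ih

theorem parse_alice (j : Fin (Nat.card (Item tm))) (x : List Bool) (w : List (Option Bool)) :
    parse inj (.alice j) (x.map some ++ none :: w) =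
      (statementItems j x).map .inl ++ parse inj (.bob false) w := by
  induction x generalizing j with
  | nil => rfl
  | cons b x ih =>
    cases b
    · exact congrArg (.inl ((Finite.equivFin (Item tm)).symm j) :: ·) (ih 0)
    · exact ih (j + 1)

theorem parse_bob (b : Bool) (y : List Bool) (w : List (Option Bool)) :
    parse inj (.bob b) (y.map some ++ none :: w) =
      .inr (y.getLastD b) :: parse inj (.alice 0) w := by
  induction y generalizing b with
  | nil => rfl
  | cons c y ih =>
    rw [List.getLastD_cons]
    exact ih c

/-- The bit by which Bob selects a half: the last bit of his statement. -/
def selectsUpper (y : List Bool) : Bool :=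
  y.getLastD false

theorem loaded_append_parse_alice {r : List (Token tm)} {I : List (Item tm) × List (Item tm)}
    (hr : LoadsAs r I) (xs : List (List Bool)) :
    loaded (r ++ parse inj (.alice 0) (xs.flatMap fun x => x.map some ++ [none])) =
      Prod.map ofItems id (halve (statementItems 0) selectsUpper I xs) := by
  induction xs using List.twoStepInduction generalizing r I with
  | nil => simpa [parse, halve] using hr.loaded_eq
  | singleton x =>
    simpa [loaded, parse_alice, parse, foldr_loadToken_map_inl, halve] using hr.loaded_eq
  | cons_cons x y xs ih =>
    simpa [parse_alice, parse_bob, markedBlock, halve, selectsUpper] using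
      ih (hr.append_markedBlock (statementItems 0 x) (selectsUpper y))

theorem encodeTranscript_append_none (q : List Bool) (xs : List (List Bool)) :
    encodeTranscript (q, xs) ++ [none] =
      q.map some ++ none :: xs.flatMap fun x => x.map some ++ [none] := by
  rw [encodeTranscript, List.append_assoc]
  congr 1
  induction xs with
  | nil => rfl
  | cons x xs ih => simp_all

/-- The tokens that precede the transcript: the block of the final configuration with output `yes`,
and the part of the block of the initial configuration that does not depend on the question. -/
def startTokens (yes : tm.Γ tm.k₁) : List (Token tm) :=
  markedBlock (haltItems [yes]) false ++ (initItems []).map .inl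

/-- All tokens of a transcript `w`. The end of `w` is read as one more separator. -/
noncomputable def transcriptTokens (yes : tm.Γ tm.k₁) (w : List (Option Bool)) : List (Token tm) :=
  startTokens yes ++ parse inj .question (w ++ [none])

theorem transcriptTokens_encodeTranscript (yes : tm.Γ tm.k₁) (q : List Bool)
    (xs : List (List Bool)) :
    transcriptTokens inj yes (encodeTranscript (q, xs)) =
      markedBlock (haltItems [yes]) false ++ markedBlock (initItems (q.map inj)) true ++
        parse inj (.alice 0) (xs.flatMap fun x => x.map some ++ [none]) := by
  rw [transcriptTokens, encodeTranscript_append_none, parse_question]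
  simp [startTokens, markedBlock, initItems, stackItems]

/-- The two points between which the debate `xs` on the question `q` leaves a single step: it
starts from the initial configuration on `q` and the final configuration with output `yes`. -/
noncomputable def debateInterval (yes : tm.Γ tm.k₁) (q : List Bool) (xs : List (List Bool)) :
    Point tm × Point tm :=
  halve statementPoint selectsUpper
    (toPoint (initList tm (q.map inj)), toPoint (haltList tm [yes])) xs

theorem loaded_transcriptTokens (yes : tm.Γ tm.k₁) (q : List Bool) (xs : List (List Bool)) :
    Prod.map id ofItems (loaded (transcriptTokens inj yes (encodeTranscript (q, xs)))) =
      debateInterval inj yes q xs := by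
  have hblocks := (loadsAs_nil.append_markedBlock (haltItems [yes]) false).append_markedBlock
    (initItems (q.map inj)) true
  rw [transcriptTokens_encodeTranscript, ← List.nil_append (markedBlock (haltItems _) _),
    loaded_append_parse_alice inj hblocks, Prod.map_map, debateInterval, ← ofItems_initItems,
    ← ofItems_haltItems]
  have hmap := halve_map id ofItems (statementItems 0) selectsUpper (initItems (q.map inj))
    (haltItems [yes]) xs
  rw [List.map_id] at hmap
  exact hmap.symm

end Parsing

end Transcripts

section Machine

variable {tm : FinTM2} [∀ k, Finite (tm.Γ k)]

/-- The stacks of the judge: input, output, parsed transcript, right endpoint, and the stacks of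
the left endpoint, on which one step of `tm` is simulated. -/
inductive JudgeStack (tm : FinTM2)
  | inp
  | out
  | rev
  | hi
  | sim (k : Option tm.K)
  deriving DecidableEq

/-- The alphabets of the judge. -/
abbrev JudgeSymbol (tm : FinTM2) : JudgeStack tm → Type
  | .inp => Option Bool
  | .out => Bool
  | .rev => Token tm
  | .hi => Item tm
  | .sim k => PointSymbol tm k

/-- The control states of the judge, which are both its labels and its internal states. Between two
steps the label equals the internal state; during the simulated step of `tm`, the internal state
`var v` holds the internal state of `tm`. -/
inductive JudgeState (tm : FinTM2) [∀ k, Finite (tm.Γ k)]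
  | start
  | parse (f : ParseState tm)
  | emit (s : Option (Token tm)) (f : Option (ParseState tm))
  | load (g : LoadState)
  | store (a : Item tm) (g : LoadState)
  | simulate
  | run (l : tm.Λ) (v : tm.σ)
  | var (v : tm.σ)
  | put (p : Option tm.Λ × tm.σ)
  | compare
  | compareItem (a : Item tm)
  | clean (b : Bool)
  | done (b : Bool)

noncomputable instance : Fintype (JudgeStack tm) :=
  have := tm.kFin
  have hcover : Set.univ ⊆ {.inp, .out, .rev, .hi} ∪ Set.range (JudgeStack.sim (tm := tm)) := by
    rintro (_ | _ | _ | _ | _) <;> simp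
  have := Set.finite_univ_iff.1 ((Set.toFinite _).subset hcover)
  .ofFinite _

instance : Finite (ParseState tm) :=
  have hcover : Set.univ ⊆ {.question} ∪ Set.range (ParseState.alice (tm := tm)) ∪
      Set.range ParseState.bob := by
    rintro (_ | _ | _) <;> simp
  Set.finite_univ_iff.1 ((Set.toFinite _).subset hcover)

instance : Finite (JudgeState tm) :=
  have := tm.ΛFin
  have := tm.σFin
  have hcover : Set.univ ⊆ {.start, .simulate, .compare} ∪ Set.range (JudgeState.parse (tm := tm)) ∪
      Set.range (Function.uncurry .emit) ∪ Set.range .load ∪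
      Set.range (Function.uncurry .store) ∪ Set.range (Function.uncurry .run) ∪
      Set.range .var ∪ Set.range .put ∪ Set.range .compareItem ∪ Set.range .clean ∪
      Set.range .done := by
    rintro (_ | _ | _ | _ | _ | _ | _ | _ | _ | _ | _ | _ | _) <;> simp
  Set.finite_univ_iff.1 ((Set.toFinite _).subset hcover)

/-- The statements of the judge. -/
abbrev JudgeStmt (tm : FinTM2) [∀ k, Finite (tm.Γ k)] : Type :=
  TM2.Stmt (JudgeSymbol tm) (JudgeState tm) (JudgeState tm)

/-- The value stored in a state `var v`; on the other states, the value is junk. -/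
def JudgeState.getVar : JudgeState tm → tm.σ
  | .var v => v
  | _ => tm.initialState

/-- The state after a token has been written: loading begins when there is no parser state left. -/
def JudgeState.resume : Option (ParseState tm) → JudgeState tm
  | some f => .parse f
  | none => .load (Finset.univ, none)

/-- The state after the header, i.e. the label and the internal state, has been popped off the left
endpoint. -/
def JudgeState.dispatch : Option (Option tm.Λ × tm.σ) → JudgeState tm
  | some (some l, v) => .run l v
  | some (none, v) => .put (none, v)
  | none => .compare

/-- Go to the label that equals the internal state. -/
def jump : JudgeStmt tm :=
  .goto id

/-- A statement of `tm`, executed on the simulation stacks. -/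
def liftStmt : TM2.Stmt tm.Γ tm.Λ tm.σ → JudgeStmt tm
  | .push k f s => .push (.sim (some k)) (fun q => f q.getVar) (liftStmt s)
  | .peek k f s => .peek (.sim (some k)) (fun q o => .var (f q.getVar o)) (liftStmt s)
  | .pop k f s => .pop (.sim (some k)) (fun q o => .var (f q.getVar o)) (liftStmt s)
  | .load f s => .load (fun q => .var (f q.getVar)) (liftStmt s)
  | .branch f s t => .branch (fun q => f q.getVar) (liftStmt s) (liftStmt t)
  | .goto f => .load (fun q => .put (some (f q.getVar), q.getVar)) jump
  | .halt => .load (fun q => .put (none, q.getVar)) jump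

variable (inj : Bool → tm.Γ tm.k₀) (yes : tm.Γ tm.k₁)

open Classical in
/-- The program of the judge: parse the transcript, load the two endpoints, simulate one step of
`tm` at the left one, compare the result with the right one, and empty all stacks before the
verdict is written. -/
noncomputable def judgeProgram : JudgeState tm → JudgeStmt tm
  | .start => pushAll .rev (startTokens yes) <| .load (fun _ => .parse .question) jump
  | .parse f => .pop .inp (fun _ o => .emit (parseSymbol inj f o.join).2
      (o.map fun _ => (parseSymbol inj f o.join).1)) jump
  | .emit s f => pushAll .rev s.toList <| .load (fun _ => .resume f) jump
  | .load g => .pop .rev (fun _ o => match o with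
      | none => .simulate
      | some (.inr b) => .load (g.mark b)
      | some (.inl a) => .store a g) jump
  | .store a (s, some true) => .push (.sim a.1) (fun _ => a.2) <|
      .load (fun _ => .load (s, some true)) jump
  | .store a (s, some false) => .push .hi (fun _ => a) <|
      .load (fun _ => .load (s, some false)) jump
  | .store _ (s, none) => .load (fun _ => .load (s, none)) jump
  | .simulate => .pop (.sim none) (fun _ o => .dispatch o) jump
  | .run l v => .load (fun _ => .var v) (liftStmt (tm.m l))
  | .var _ => .halt
  | .put p => .push (.sim none) (fun _ => p) <| .load (fun _ => .compare) jump
  | .compare => .pop .hi (fun _ o => o.elim (.clean true) .compareItem) jump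
  | .compareItem a => .pop (.sim a.1)
      (fun _ o => if o = some a.2 then .compare else .clean false) jump
  | .clean b => .load (fun _ => .done b) (popAll Finset.univ.toList (.clean false) jump)
  | .done b => .push .out (fun _ => b) <| .load (fun _ => .start) .halt

/-- The Turing machine of the judge. -/
noncomputable def judgeTM : FinTM2 where
  K := JudgeStack tm
  kFin := inferInstance
  k₀ := .inp
  k₁ := .out
  Γ := JudgeSymbol tm
  Λ := JudgeState tm
  main := .start
  ΛFin := .ofFinite _
  σ := JudgeState tm
  initialState := .start
  σFin := .ofFinite _
  Γk₀Fin := inferInstanceAs (Fintype (Option Bool))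
  m := judgeProgram inj yes

end Machine

section Execution

variable {tm : FinTM2}

/-- The stacks of the judge, with empty output, transcript `i`, parsed transcript `r`, right
endpoint `h` and left endpoint `X`. -/
def judgeStacks (i : List (Option Bool)) (r : List (Token tm)) (h : List (Item tm))
    (X : Point tm) : ∀ k, List (JudgeSymbol tm k)
  | .inp => i
  | .out => []
  | .rev => r
  | .hi => h
  | .sim k => X k

section Stacks

variable {i : List (Option Bool)} {r : List (Token tm)} {h : List (Item tm)} {X : Point tm}

theorem update_inp_judgeStacks (l : List (Option Bool)) :
    Function.update (judgeStacks i r h X) .inp l = judgeStacks l r h X :=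
  Function.update_eq_iff.2 ⟨rfl, by
    rintro (_ | _ | _ | _ | _) hk <;> first | rfl | exact absurd rfl hk⟩

theorem update_rev_judgeStacks (l : List (Token tm)) :
    Function.update (judgeStacks i r h X) .rev l = judgeStacks i l h X :=
  Function.update_eq_iff.2 ⟨rfl, by
    rintro (_ | _ | _ | _ | _) hk <;> first | rfl | exact absurd rfl hk⟩

theorem update_hi_judgeStacks (l : List (Item tm)) :
    Function.update (judgeStacks i r h X) .hi l = judgeStacks i r l X :=
  Function.update_eq_iff.2 ⟨rfl, by
    rintro (_ | _ | _ | _ | _) hk <;> first | rfl | exact absurd rfl hk⟩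

theorem update_sim_judgeStacks (k : Option tm.K) (l : List (PointSymbol tm k)) :
    Function.update (judgeStacks i r h X) (.sim k) l =
      judgeStacks i r h (Function.update X k l) := by
  refine Function.update_eq_iff.2
    ⟨(Function.update_self (β := fun k => List (PointSymbol tm k)) ..).symm, ?_⟩
  rintro (_ | _ | _ | _ | k') hk
  case sim =>
    have hk' : k' ≠ k := by simpa using hk
    exact (Function.update_of_ne (β := fun k => List (PointSymbol tm k)) hk' ..).symm
  all_goals rfl

theorem length_judgeStacks_le {B : ℕ} (hh : h.length ≤ B) (hX : ∀ k, (X k).length ≤ B)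
    (k : JudgeStack tm) : (judgeStacks [] [] h X k).length ≤ B := by
  rcases k with _ | _ | _ | _ | k
  case hi => exact hh
  case sim => exact hX k
  all_goals exact Nat.zero_le _

theorem judgeStacks_eq_nil_iff : (∀ k, judgeStacks [] [] [] X k = []) ↔ X = ofItems [] := by
  constructor
  · exact fun hS => funext fun k => hS (.sim k)
  · rintro rfl (_ | _ | _ | _ | k) <;> rfl

end Stacks

variable [∀ k, Finite (tm.Γ k)]

/-- The running configurations of the judge that occur between two steps. -/
def judgeCfg (q : JudgeState tm) (S : ∀ k, List (JudgeSymbol tm k)) :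
    TM2.Cfg (JudgeSymbol tm) (JudgeState tm) (JudgeState tm) :=
  ⟨some q, q, S⟩

/-- The final configuration of the judge. -/
def judgeHalt (b : Bool) : TM2.Cfg (JudgeSymbol tm) (JudgeState tm) (JudgeState tm) :=
  ⟨none, .start, Function.update (fun _ => []) .out [b]⟩

theorem stepAux_liftStmt (s : TM2.Stmt tm.Γ tm.Λ tm.σ) (v : tm.σ) (t : List (Option tm.Λ × tm.σ))
    (S : ∀ k, List (tm.Γ k)) (i : List (Option Bool)) (r : List (Token tm)) (h : List (Item tm)) :
    TM2.stepAux (liftStmt s) (.var v) (judgeStacks i r h (Point.mk t S)) =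
      judgeCfg (.put ((TM2.stepAux s v S).l, (TM2.stepAux s v S).var))
        (judgeStacks i r h (Point.mk t (TM2.stepAux s v S).stk)) := by
  induction s generalizing v S with
  | push k f s ih | pop k f s ih =>
    simp only [liftStmt, TM2.stepAux]
    rw [update_sim_judgeStacks, ← ih, ← Point.update_mk_some]
    rfl
  | peek _ _ _ ih | load _ _ ih => exact ih _ _
  | branch f s t ihs iht =>
    simp only [liftStmt, TM2.stepAux, JudgeState.getVar]
    cases f v
    · exact iht _ _
    · exact ihs _ _
  | goto | halt => rfl

variable (inj : Bool → tm.Γ tm.k₀) (yes : tm.Γ tm.k₁)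

section Steps

variable (i : List (Option Bool)) (r : List (Token tm)) (h : List (Item tm)) (X : Point tm)

theorem step_start :
    TM2.step (judgeProgram inj yes) (judgeCfg .start (judgeStacks i r h X)) =
      some (judgeCfg (.parse .question) (judgeStacks i ((startTokens yes).reverse ++ r) h X)) := by
  simp only [judgeCfg, TM2.step, judgeProgram, stepAux_pushAll, update_rev_judgeStacks]
  rfl

theorem step_parse (f : ParseState tm) :
    TM2.step (judgeProgram inj yes) (judgeCfg (.parse f) (judgeStacks i r h X)) =
      some (judgeCfg (.emit (parseSymbol inj f i.head?.join).2
        (i.head?.map fun _ => (parseSymbol inj f i.head?.join).1)) (judgeStacks i.tail r h X)) := by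
  simp only [judgeCfg, TM2.step, judgeProgram, TM2.stepAux, update_inp_judgeStacks]
  rfl

theorem step_emit (s : Option (Token tm)) (f : Option (ParseState tm)) :
    TM2.step (judgeProgram inj yes) (judgeCfg (.emit s f) (judgeStacks i r h X)) =
      some (judgeCfg (.resume f) (judgeStacks i (s.toList.reverse ++ r) h X)) := by
  simp only [judgeCfg, TM2.step, judgeProgram, stepAux_pushAll, update_rev_judgeStacks]
  rfl

theorem step_load_nil (g : LoadState) :
    TM2.step (judgeProgram inj yes) (judgeCfg (.load g) (judgeStacks i [] h X)) =
      some (judgeCfg .simulate (judgeStacks i [] h X)) := by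
  simp only [judgeCfg, TM2.step, judgeProgram, TM2.stepAux, update_rev_judgeStacks]
  rfl

theorem step_load_inr (g : LoadState) (b : Bool) :
    TM2.step (judgeProgram inj yes) (judgeCfg (.load g) (judgeStacks i (.inr b :: r) h X)) =
      some (judgeCfg (.load (g.mark b)) (judgeStacks i r h X)) := by
  simp only [judgeCfg, TM2.step, judgeProgram, TM2.stepAux, update_rev_judgeStacks]
  rfl

theorem step_load_inl (g : LoadState) (a : Item tm) :
    TM2.step (judgeProgram inj yes) (judgeCfg (.load g) (judgeStacks i (.inl a :: r) h X)) =
      some (judgeCfg (.store a g) (judgeStacks i r h X)) := by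
  simp only [judgeCfg, TM2.step, judgeProgram, TM2.stepAux, update_rev_judgeStacks]
  rfl

theorem step_store (g : LoadState) (a : Item tm) :
    TM2.step (judgeProgram inj yes) (judgeCfg (.store a g) (judgeStacks i r h X)) =
      some (judgeCfg (.load (loadToken (.inl a) (g, X, h)).1) <|
        judgeStacks i r (loadToken (.inl a) (g, X, h)).2.2 (loadToken (.inl a) (g, X, h)).2.1) := by
  rcases g with ⟨s, _ | _ | _⟩ <;>
    simp only [judgeCfg, TM2.step, judgeProgram, TM2.stepAux, update_hi_judgeStacks,
      update_sim_judgeStacks] <;>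
    rfl

theorem step_simulate :
    TM2.step (judgeProgram inj yes) (judgeCfg .simulate (judgeStacks i r h X)) =
      some (judgeCfg (.dispatch (X none).head?)
        (judgeStacks i r h (Function.update X none (X none).tail))) := by
  simp only [judgeCfg, TM2.step, judgeProgram, TM2.stepAux, update_sim_judgeStacks]
  rfl

theorem step_run (l : tm.Λ) (v : tm.σ) (t : List (Option tm.Λ × tm.σ)) (S : ∀ k, List (tm.Γ k)) :
    TM2.step (judgeProgram inj yes) (judgeCfg (.run l v) (judgeStacks i r h (Point.mk t S))) =
      some (judgeCfg (.put ((TM2.stepAux (tm.m l) v S).l, (TM2.stepAux (tm.m l) v S).var))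
        (judgeStacks i r h (Point.mk t (TM2.stepAux (tm.m l) v S).stk))) :=
  congrArg some (stepAux_liftStmt (tm.m l) v t S i r h)

theorem step_put (p : Option tm.Λ × tm.σ) :
    TM2.step (judgeProgram inj yes) (judgeCfg (.put p) (judgeStacks i r h X)) =
      some (judgeCfg .compare (judgeStacks i r h (Function.update X none (p :: X none)))) := by
  simp only [judgeCfg, TM2.step, judgeProgram, TM2.stepAux, update_sim_judgeStacks]
  rfl

theorem step_compare_nil :
    TM2.step (judgeProgram inj yes) (judgeCfg .compare (judgeStacks i r [] X)) =
      some (judgeCfg (.clean true) (judgeStacks i r [] X)) := by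
  simp only [judgeCfg, TM2.step, judgeProgram, TM2.stepAux, update_hi_judgeStacks]
  rfl

theorem step_compare_cons (a : Item tm) :
    TM2.step (judgeProgram inj yes) (judgeCfg .compare (judgeStacks i r (a :: h) X)) =
      some (judgeCfg (.compareItem a) (judgeStacks i r h X)) := by
  simp only [judgeCfg, TM2.step, judgeProgram, TM2.stepAux, update_hi_judgeStacks]
  rfl

open Classical in
theorem step_compareItem (a : Item tm) :
    TM2.step (judgeProgram inj yes) (judgeCfg (.compareItem a) (judgeStacks i r h X)) =
      some (judgeCfg (if (X a.1).head? = some a.2 then .compare else .clean false)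
        (judgeStacks i r h (Function.update X a.1 (X a.1).tail))) := by
  simp only [judgeCfg, TM2.step, judgeProgram, TM2.stepAux, update_sim_judgeStacks]
  rfl

open Classical in
theorem step_clean (b : Bool) (S : ∀ k, List (JudgeSymbol tm k)) :
    TM2.step (judgeProgram inj yes) (judgeCfg (.clean b) S) =
      some (judgeCfg (if ∀ k, S k = [] then .done b else .clean false) fun k => (S k).tail) := by
  refine congrArg some ((stepAux_popAll (Finset.nodup_toList _) ..).trans ?_)
  simp [jump, TM2.stepAux, judgeCfg]

end Steps

theorem reaches_parse (f : ParseState tm) (i : List (Option Bool)) (r : List (Token tm))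
    (h : List (Item tm)) (X : Point tm) :
    ReachesWithin (TM2.step (judgeProgram inj yes)) (2 * i.length + 2)
      (judgeCfg (.parse f) (judgeStacks i r h X))
      (judgeCfg (.load (Finset.univ, none))
        (judgeStacks [] ((parse inj f (i ++ [none])).reverse ++ r) h X)) := by
  induction i generalizing f r with
  | nil =>
    have hstep := ReachesWithin.head (step_parse inj yes [] r h X f) (.single (step_emit ..))
    rwa [List.nil_append, parse, parse, List.append_nil]
  | cons c i ih =>
    have hstep := ReachesWithin.head (step_parse inj yes (c :: i) r h X f)
      (.head (step_emit ..) (ih ..))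
    simpa [parse, mul_add] using hstep

theorem reaches_loadToken (t : Token tm) (g : LoadState) (r : List (Token tm)) (h : List (Item tm))
    (X : Point tm) :
    ReachesWithin (TM2.step (judgeProgram inj yes)) 2
      (judgeCfg (.load g) (judgeStacks [] (t :: r) h X))
      (judgeCfg (.load (loadToken t (g, X, h)).1)
        (judgeStacks [] r (loadToken t (g, X, h)).2.2 (loadToken t (g, X, h)).2.1)) := by
  rcases t with a | b
  · exact .head (step_load_inl ..) (.single (step_store ..))
  · exact (ReachesWithin.single (step_load_inr ..)).mono one_le_two

theorem reaches_load (r : List (Token tm)) (z : LoadState × Point tm × List (Item tm)) :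
    ReachesWithin (TM2.step (judgeProgram inj yes)) (2 * r.length + 1)
      (judgeCfg (.load z.1) (judgeStacks [] r.reverse z.2.2 z.2.1))
      (judgeCfg .simulate
        (judgeStacks [] [] (r.foldr loadToken z).2.2 (r.foldr loadToken z).2.1)) := by
  induction r using List.reverseRecOn generalizing z with
  | nil => exact .single (step_load_nil ..)
  | append_singleton r t ih =>
    rw [List.reverse_concat, List.foldr_concat]
    exact ((reaches_loadToken ..).trans (ih _)).mono (by simp; omega)

theorem reaches_simulate (h : List (Item tm)) (X : Point tm) :
    ReachesWithin (TM2.step (judgeProgram inj yes)) 3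
      (judgeCfg .simulate (judgeStacks [] [] h X))
      (judgeCfg .compare (judgeStacks [] [] h (pointStep X))) := by
  have hpop := step_simulate inj yes [] [] h X
  rcases hX : X none with _ | ⟨⟨_ | l, v⟩, t⟩ <;> rw [hX] at hpop
  · rw [List.tail_nil, ← hX, Function.update_eq_self] at hpop
    simpa [pointStep, hX, JudgeState.dispatch] using
      (ReachesWithin.single hpop).mono (by omega : 1 ≤ 3)
  · have hput := step_put inj yes [] [] h (Function.update X none t) (none, v)
    rw [Function.update_self, Function.update_idem, ← hX, Function.update_eq_self] at hput
    simpa [pointStep, hX, JudgeState.dispatch] using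
      ((ReachesWithin.single hput).head hpop).mono (by omega : 2 ≤ 3)
  · have hupdate : Function.update X none t = Point.mk t fun k => X (some k) := by
      rw [← Point.update_mk_none (X none), Point.mk_eta]
    rw [List.tail_cons, hupdate] at hpop
    refine .head hpop (.head (step_run ..) (.single ?_))
    rw [step_put, Point.update_mk_none]
    simp only [pointStep, hX]
    rfl

theorem step_done (b : Bool) :
    TM2.step (judgeProgram inj yes) (judgeCfg (.done b) fun _ => []) = some (judgeHalt b) :=
  rfl

open Classical in
theorem reaches_clean {B : ℕ} {S : ∀ k, List (JudgeSymbol tm k)} (hS : ∀ k, (S k).length ≤ B)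
    (b : Bool) :
    ReachesWithin (TM2.step (judgeProgram inj yes)) (B + 2) (judgeCfg (.clean b) S)
      (judgeHalt (b && decide (∀ k, S k = []))) := by
  have hempty {S : ∀ k, List (JudgeSymbol tm k)} (h : ∀ k, S k = []) (b : Bool) :
      ReachesWithin (TM2.step (judgeProgram inj yes)) 2 (judgeCfg (.clean b) S)
        (judgeHalt (b && decide (∀ k, S k = []))) := by
    have hclean := step_clean inj yes b S
    simp only [h, implies_true, if_true, List.tail_nil] at hclean
    simpa [h] using ReachesWithin.head hclean (.single (step_done inj yes b))
  induction B generalizing S b with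
  | zero => exact hempty (fun k => List.length_eq_zero_iff.1 (Nat.le_zero.1 (hS k))) b
  | succ B ih =>
    by_cases h : ∀ k, S k = []
    · exact (hempty h b).mono (by omega)
    · have hclean := step_clean inj yes b S
      rw [if_neg h] at hclean
      have hrest := ih (S := fun k => (S k).tail)
        (fun k => by simpa using Nat.sub_le_of_le_add (hS k)) false
      simpa [h] using ReachesWithin.head hclean hrest

open Classical in
theorem reaches_compare {B : ℕ} {h : List (Item tm)} {X : Point tm} (hh : h.length ≤ B)
    (hX : ∀ k, (X k).length ≤ B) :
    ReachesWithin (TM2.step (judgeProgram inj yes)) (2 * h.length + 1 + (B + 2))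
      (judgeCfg .compare (judgeStacks [] [] h X)) (judgeHalt (decide (X = ofItems h))) := by
  induction h generalizing X with
  | nil =>
    have hclean := reaches_clean inj yes (length_judgeStacks_le hh hX) true
    simp only [judgeStacks_eq_nil_iff, Bool.true_and] at hclean
    exact (ReachesWithin.head (step_compare_nil ..) hclean).mono (by simp)
  | cons a h ih =>
    have hpop : X = ofItems (a :: h) ↔ (X a.1).head? = some a.2 ∧
        Function.update X a.1 (X a.1).tail = ofItems h := by
      rw [eq_comm, @eq_comm _ _ (ofItems h)]
      exact pushItem_eq_iff a (ofItems h) X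
    have hh : h.length ≤ B := (Nat.le_succ _).trans hh
    have hX (k) : (Function.update X a.1 (X a.1).tail k).length ≤ B := by
      obtain rfl | hk := eq_or_ne k a.1
      · simpa using (hX a.1).trans (Nat.le_succ B)
      · simpa [hk] using hX k
    have hcompare := step_compareItem inj yes [] [] h X a
    by_cases ha : (X a.1).head? = some a.2
    · rw [if_pos ha] at hcompare
      simp only [hpop, ha, true_and]
      exact (ReachesWithin.head (step_compare_cons ..) (.head hcompare (ih hh hX))).mono
        (by simp; omega)
    · rw [if_neg ha] at hcompare
      simp only [hpop, ha, false_and, decide_false]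
      exact (ReachesWithin.head (step_compare_cons ..) (.head hcompare
        (reaches_clean inj yes (length_judgeStacks_le hh hX) false))).mono (by simp; omega)

theorem length_transcriptTokens_le (w : List (Option Bool)) :
    (transcriptTokens inj yes w).length ≤ w.length + 5 := by
  have := length_parse_le inj .question (w ++ [none])
  simp only [List.length_append, List.length_singleton] at this
  simp [transcriptTokens, startTokens, markedBlock, haltItems, initItems, stackItems]
  omega

open Classical in
theorem reaches_judgeHalt_of_tokens (r : List (Token tm)) :
    ReachesWithin (TM2.step (judgeProgram inj yes)) (5 * r.length + (maxPush tm + 7))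
      (judgeCfg (.load (Finset.univ, none)) (judgeStacks [] r.reverse [] fun _ => []))
      (judgeHalt (decide (IsStep pointStep (Prod.map id ofItems (loaded r))))) := by
  have hload := reaches_load inj yes r ((Finset.univ, none), fun _ => [], [])
  obtain ⟨hX, hh⟩ := length_foldr_loadToken_le r ((Finset.univ, none), fun _ => [], [])
  change ∀ k, ((loaded r).1 k).length ≤ _ at hX
  change (loaded r).2.length ≤ _ at hh
  simp only [List.length_nil, zero_add] at hX hh
  have hcompare := reaches_compare inj yes (h := (loaded r).2) (X := pointStep (loaded r).1)
    (B := r.length + maxPush tm) (hh.trans (by omega))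
    fun k => (length_pointStep_le _ k).trans (by have := hX k; omega)
  exact (hload.trans ((reaches_simulate ..).trans hcompare)).mono (by omega)

open Classical in
theorem reaches_judgeHalt (w : List (Option Bool)) :
    ReachesWithin (TM2.step (judgeProgram inj yes)) (7 * w.length + (maxPush tm + 35))
      (judgeCfg .start (judgeStacks w [] [] fun _ => []))
      (judgeHalt (decide (IsStep pointStep
        (Prod.map id ofItems (loaded (transcriptTokens inj yes w)))))) := by
  have hstart := step_start inj yes w [] [] fun _ => []
  have hparse := reaches_parse inj yes .question w ((startTokens yes).reverse ++ []) [] fun _ => []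
  rw [List.append_nil, ← List.reverse_append, ← transcriptTokens] at hparse
  rw [List.append_nil] at hstart
  have hlen := length_transcriptTokens_le inj yes w
  exact (ReachesWithin.head hstart
    (hparse.trans (reaches_judgeHalt_of_tokens inj yes _))).mono (by omega)

end Execution

section Judge

variable {tm : FinTM2} [∀ k, Finite (tm.Γ k)] (inj : Bool → tm.Γ tm.k₀) (yes : tm.Γ tm.k₁)

open Classical in
/-- The judge: Alice wins if the interval that remains at the end of the debate is a step. -/
noncomputable def judge (q : List Bool) (xs : List (List Bool)) : Bool :=
  decide (IsStep pointStep (debateInterval inj yes q xs))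

theorem judge_eq_true_iff (q : List Bool) (xs : List (List Bool)) :
    judge inj yes q xs = true ↔ IsStep pointStep (debateInterval inj yes q xs) :=
  @decide_eq_true_iff _ (_)

theorem initList_judgeTM (w : List (Option Bool)) :
    initList (judgeTM inj yes) w = judgeCfg .start (judgeStacks w [] [] fun _ => []) := by
  unfold initList judgeCfg
  congr 1
  funext k
  rcases k with _ | _ | _ | _ | k
  case inp => exact dif_pos rfl
  all_goals exact dif_neg (by simp [judgeTM])

theorem haltList_judgeTM (b : Bool) : haltList (judgeTM inj yes) [b] = judgeHalt b := by
  unfold haltList judgeHalt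
  congr 1
  funext k
  rcases k with _ | _ | _ | _ | k
  case out => exact dif_pos rfl
  all_goals exact dif_neg (by simp [judgeTM])

theorem isPolyTimeJudge_judge : IsPolyTimeJudge (judge inj yes) := by
  have hrun (t : List Bool × List (List Bool)) :
      ReachesWithin (judgeTM inj yes).step (7 * (encodeTranscript t).length + (maxPush tm + 35))
        (initList (judgeTM inj yes) (encodeTranscript t))
        (haltList (judgeTM inj yes) [judge inj yes t.1 t.2]) := by
    rw [initList_judgeTM, haltList_judgeTM, judge, ← loaded_transcriptTokens]
    exact reaches_judgeHalt ..
  refine ⟨⟨⟨judgeTM inj yes, Equiv.refl _, Equiv.refl _⟩,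
    7 * Polynomial.X + Polynomial.C (maxPush tm + 35), fun t => ?_⟩, ?_⟩
  · unfold TM2OutputsInTime
    convert (hrun t).some using 2
    · exact congrArg _ (List.map_id _)
    · rfl
    · simp
  · intro k
    have := finite_pointSymbol (tm := tm)
    change Finite (JudgeSymbol tm k)
    cases k <;> simp only [JudgeSymbol] <;> infer_instance

end Judge

section Decision

theorem card_move_le (m : ℕ) : Nat.card (Move m) ≤ 2 ^ (2 * m) :=
  calc
    Nat.card (Move m) ≤ (Nat.card Bool + 1) ^ m := card_list_length_le m
    _ ≤ (2 ^ 2) ^ m := by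
      gcongr
      simp
    _ = 2 ^ (2 * m) := (pow_mul ..).symm

theorem selectsUpper_surjective {m : ℕ} (hm : 1 ≤ m) :
    Function.Surjective fun y : Move m => selectsUpper y.1 :=
  fun b => ⟨⟨[b], hm⟩, rfl⟩

variable {tm : FinTM2} [∀ k, Finite (tm.Γ k)]

theorem exists_statementPoint_eq_iterate {c : tm.Cfg} {s : ℕ}
    (hs : ∀ c', Reaches tm.step c c' → cfgSpace tm c' ≤ s) (i : ℕ) :
    ∃ x : Move (Nat.card (Item tm) * (s + 1)), statementPoint x.1 = pointStep^[i] (toPoint c) := by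
  rw [iterate_pointStep_toPoint]
  exact exists_statementPoint_eq (hs _ (reaches_iterate_stayingStep ..))

theorem iterate_two_pow_pointStep_eq {c : tm.Cfg} {s : ℕ}
    (hs : ∀ c', Reaches tm.step c c' → cfgSpace tm c' ≤ s) {y : List (tm.Γ tm.k₁)}
    (hy : EvalsTo tm.step c (some (haltList tm y))) :
    pointStep^[2 ^ (2 * (Nat.card (Item tm) * (s + 1)))] (toPoint c) = toPoint (haltList tm y) := by
  refine iterate_card_eq_of_orbit_subset_range _ (exists_statementPoint_eq_iterate hs) rfl
    (n := hy.steps) ?_ (card_move_le _)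
  rw [iterate_pointStep_toPoint, iterate_stayingStep_of_evalsTo hy]

theorem alternating_judge_iff (inj : Bool → tm.Γ tm.k₀) (yes : tm.Γ tm.k₁) {q : List Bool} {m : ℕ}
    (hm : 1 ≤ m) (T : ℕ)
    (horbit : ∀ i, ∃ x : Move m,
      statementPoint x.1 = pointStep^[i] (toPoint (initList tm (q.map inj)))) :
    (Alternating true (2 * T + 1) fun l : List (Move m) => verdict (judge inj yes) q l = true) ↔
      pointStep^[2 ^ T] (toPoint (initList tm (q.map inj))) = toPoint (haltList tm [yes]) := by
  have hverdict (l : List (Move m)) : verdict (judge inj yes) q l = true ↔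
      IsStep pointStep (halve (fun x : Move m => statementPoint x.1) (fun y => selectsUpper y.1)
        (toPoint (initList tm (q.map inj)), toPoint (haltList tm [yes])) l) := by
    rw [verdict, judge_eq_true_iff, debateInterval]
    exact (congrArg (IsStep pointStep) (halve_map Subtype.val id ..)).to_iff.symm
  simp only [hverdict]
  exact ⟨iterate_eq_of_alternating (selectsUpper_surjective hm) T,
    alternating_of_iterate_eq T horbit⟩

theorem exists_judge_of_inPSPACE {L : Language Bool} (hL : InPSPACE L) :
    ∃ (H : List Bool → List (List Bool) → Bool) (n m : Polynomial ℕ), IsPolyTimeJudge H ∧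
      (∀ k : ℕ, Odd (n.eval k)) ∧
      ∀ q : List Bool, q ∈ L ↔ Alternating true (n.eval q.length)
        fun l : List (Move (m.eval q.length)) => verdict H q l = true := by
  obtain ⟨f, M, s, hfin, hf, hs⟩ := hL
  set inj := M.inputAlphabet.invFun
  set out := M.outputAlphabet.invFun
  set m : Polynomial ℕ := Polynomial.C (Nat.card (Item M.tm)) * (s + 1) with hm
  refine ⟨judge inj (out true), 2 * (2 * m) + 1, m, isPolyTimeJudge_judge inj _,
    fun k => ⟨2 * m.eval k, by simp⟩, fun q => ?_⟩
  have hm_eval : m.eval q.length = Nat.card (Item M.tm) * (s.eval q.length + 1) := by simp [hm]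
  have hm_pos : 1 ≤ m.eval q.length := hm_eval ▸ Nat.mul_pos Nat.card_pos (Nat.succ_pos _)
  have hn_eval : (2 * (2 * m) + 1).eval q.length = 2 * (2 * m.eval q.length) + 1 := by simp
  have horbit := exists_statementPoint_eq_iterate (hs q)
  have hresult : pointStep^[2 ^ (2 * m.eval q.length)] (toPoint (initList M.tm (q.map inj))) =
      toPoint (haltList M.tm [out (f q)]) :=
    hm_eval ▸ iterate_two_pow_pointStep_eq (hs q) (M.outputsFun q)
  rw [← hm_eval] at horbit
  rw [hn_eval, alternating_judge_iff inj (out true) hm_pos _ horbit, hresult, ← hf,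
    toPoint_injective.eq_iff, (haltList_injective _).eq_iff, List.singleton_inj]
  exact M.outputAlphabet.symm.injective.eq_iff.symm

end Decision

end Debate

theorem mainTheorem1 (L : Language Bool) (hL : Debate.InPSPACE L) :
    ∃ (H : List Bool → List (List Bool) → Bool) (n m : Polynomial ℕ),
      Debate.IsPolyTimeJudge H ∧
      (∀ k : ℕ, Odd (n.eval k)) ∧
      ∀ q : List Bool,
        (q ∈ L ↔ Debate.Alternating true (n.eval q.length)
          fun l : List (Debate.Move (m.eval q.length)) => Debate.verdict H q l = true) ∧
        (∃ σ τ : Debate.Strategy (m.eval q.length),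
          Debate.IsOptimalPlay H q (n.eval q.length) σ τ) ∧
        ∀ σ τ : Debate.Strategy (m.eval q.length),
          Debate.IsOptimalPlay H q (n.eval q.length) σ τ →
            (Debate.verdict H q (Debate.play σ τ (n.eval q.length)) = true ↔ q ∈ L) := by
  obtain ⟨H, n, m, hH, hn, h⟩ := Debate.exists_judge_of_inPSPACE hL
  exact ⟨H, n, m, hH, hn, fun q => ⟨h q, Debate.exists_isOptimalPlay H q _ _,
    fun σ τ hστ => hστ.verdict_eq_true_iff.trans (h q).symm⟩⟩
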